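/- **Setting.** For $t>0$ let $J_0,Y_0$ be the Bessel functions of order $0$ of the first and second kind, $H_0^{(1)}=J_0+\mathrm iY_0$, and $G_k(x,y)=-\frac{\mathrm i}{4}H_0^{(1)}(k|x-y|)$ for $x\neq y$ in $\mathbb R^2$. Let $a>0$, $\Omega_0=(-a,a)^2$, and let $g,\sigma$ be real functions on $\mathbb R^2$ with compact support contained in $\Omega_0$, $\sigma\ge 0$, $g\in L^2(\Omega_0)$, $\sigma\in L^4(\Omega_0)$. Let $W$ be Gaussian white noise on $\mathbb R^2$ over a probability space, i.e. $f\mapsto\int f\,\mathrm dW$ $(f\in L^2(\mathbb R^2;\mathbb R))$ is a centred Gaussian family with $\mathbf{Cov}(\int f\,\mathrm dW,\int h\,\mathrm dW)=\int fh\,\mathrm dx$. Let $u$ be the mild solution at wavenumber $k$ of $\Delta u+k^2u=g+\sigma\dot W$ with the Sommerfeld radiation condition, i.e. the (almost surely) continuous random field with, for every $x\in\mathbb R^2$, almost surely $$u(x)=\int_{\Omega_0}G_k(x,y)g(y)\,\mathrm dy+\int_{\Omega_0}G_k(x,y)\sigma(y)\,\mathrm dW_y .$$ **Parameters.** Let $k^*=\frac{\pi}{30a}$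 and $\mathbb K=\{\frac{\pi}{a}s:\ s\ge 1\}\cup\{k^*\}$. Let $k\in\mathbb K$, let $m\ge 10$ be an integer, $\tau\ge 6$, $\lambda_1=\frac12$, and $$R=\tau a,\ \lambda_2=\tfrac12+\tfrac{\pi}{2kR}\ \text{ if } k\ne k^*,\qquad R=6a,\ \lambda_2=-\tfrac32\ \text{ if } k=k^*.$$ Put $M=\frac{20\tau-7}{20\tau}$, $M^*=\frac49$ and $\nu_\mu=\mu\pi/m$. For $j\in\{1,\dots,m\}$ let $$\partial B_j=\{R(\cos\theta,\sin\theta):\nu_{2j-2}\le\theta\le\nu_{2j}\},\qquad z_{j,\ell}=\lambda_\ell R(\cos\nu_{2j-1},\sin\nu_{2j-1}),\quad \ell=1,2,$$ and, with the scaling factors equal to $1$, let $v_{j,\ell}(x)=u(x)+G_k(x,z_{j,\ell})$. **Theorem.** There is a constant $\widetilde C=\widetilde C(k,R,M,M^*,\lambda_2)$, depending only on the listed quantities, such that in the above setting, for every $j\in\{1,\dots,m\}$ and every $x\in\partial B_j$, $$\begin{aligned}&|\mathbf{Var}(\operatorname{Re}u)|+|\mathbf{Cov}(\operatorname{Re}u,\operatorname{Im}u)|+|\mathbf{Var}(\operatorname{Im}u)|\\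 &\le\widetilde C\sum_{1\le l_1\le l_2\le 2}\Big(|\mathbf{Cov}(|v_{j,l_1}|^2,|v_{j,l_2}|^2)|+|\mathbf{Cov}(|u|^2,|v_{j,l_1}|^2)|+|\mathbf{Cov}(|u|^2,|v_{j,l_2}|^2)|+|\mathbf{Var}(|u|^2)|\Big),\end{aligned}$$ where all the random variables are evaluated at the point $x$. -/

import Mathlib

open MeasureTheory ProbabilityTheory

noncomputable section

namespace PhaselessSource

/-- The Euclidean plane. -/
abbrev Plane : Type := EuclideanSpace ℝ (Fin 2)

/-! ### Bessel functions of order zero and the Green function -/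

/-- The Bessel function of the first kind of order zero, on the real line. -/
def besselJ0 (t : ℝ) : ℝ :=
  ∑' p : ℕ, (-1 : ℝ) ^ p / ((p.factorial : ℝ) ^ 2) * (t / 2) ^ (2 * p)

/-- The Bessel function of the second kind of order zero, for `t > 0`.
The term `p = 0` of the second series vanishes, since `harmonic 0 = 0`. -/
def besselY0 (t : ℝ) : ℝ :=
  2 / Real.pi * besselJ0 t * (Real.log (t / 2) + Real.eulerMascheroniConstant)
    - 2 / Real.pi *
      ∑' p : ℕ, (-1 : ℝ) ^ p * ((harmonic p : ℚ) : ℝ) / ((p.factorial : ℝ) ^ 2)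
        * (t / 2) ^ (2 * p)

/-- The Hankel function of the first kind of order zero, for `t > 0`. -/
def hankelH0 (t : ℝ) : ℂ := (besselJ0 t : ℂ) + Complex.I * (besselY0 t : ℂ)

/-- The outgoing Green function of `Δ + k ^ 2` in the plane. -/
def greenFn (k : ℝ) (x y : Plane) : ℂ := -(Complex.I / 4) * hankelH0 (k * ‖x - y‖)

/-! ### White noise and the random wave field -/

/-- Gaussian white noise on the plane, in the form of its Wiener integral
`f ↦ ∫ f dW` on `L²`: a jointly Gaussian, centred family of real random variables
whose covariance is the `L²` inner product. -/
structure IsWhiteNoise {Ω : Type*} [MeasurableSpace Ω] (P : Measure Ω)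
    (W : Lp ℝ 2 (volume : Measure Plane) → Ω → ℝ) : Prop where
  gaussian : IsGaussianProcess W P
  mean_zero : ∀ f, ∫ ω, W f ω ∂P = 0
  covariance_eq : ∀ f h, cov[W f, W h; P] = inner ℝ f h

open Classical in
/-- The Wiener integral `∫ f dW` of a real function `f ∈ L²` (and `0` for `f ∉ L²`). -/
def wienerIntegral {Ω : Type*} (W : Lp ℝ 2 (volume : Measure Plane) → Ω → ℝ)
    (f : Plane → ℝ) (ω : Ω) : ℝ :=
  if hf : MemLp f 2 (volume : Measure Plane) then W (hf.toLp f) ω else 0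

/-- The Wiener integral of a complex function. -/
def wienerIntegralC {Ω : Type*} (W : Lp ℝ 2 (volume : Measure Plane) → Ω → ℝ)
    (f : Plane → ℂ) (ω : Ω) : ℂ :=
  (wienerIntegral W (fun y => (f y).re) ω : ℂ)
    + Complex.I * (wienerIntegral W (fun y => (f y).im) ω : ℂ)

/-- The open square `(-a, a)²`. -/
def sourceSquare (a : ℝ) : Set Plane := {y | ∀ i, -a < y i ∧ y i < a}

/-- `u` is the mild solution, at wavenumber `k`, of the scattering problem with the random source
`g + σ Ẇ` in the square `(-a, a)²`: a continuous process with
`u(x) = ∫ G_k(x, y) g(y) dy + ∫ G_k(x, y) σ(y) dW_y` almost surely, for each `x`. -/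
structure IsMildSolution {Ω : Type*} [MeasurableSpace Ω] (P : Measure Ω)
    (W : Lp ℝ 2 (volume : Measure Plane) → Ω → ℝ) (a k : ℝ) (g σ : Plane → ℝ)
    (u : Plane → Ω → ℂ) : Prop where
  continuous_paths : ∀ᵐ ω ∂P, Continuous fun x => u x ω
  eq_integral : ∀ x, ∀ᵐ ω ∂P,
    u x ω = (∫ y in sourceSquare a, greenFn k x y * (g y : ℂ))
      + wienerIntegralC W
          ((sourceSquare a).indicator fun y => greenFn k x y * (σ y : ℂ)) ω

/-- The field `v = u + c G_k(·, z)` radiated by the source together with an artificial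
point source of strength `c` at `z`. -/
def referenceField {Ω : Type*} (c k : ℝ) (z : Plane) (u : Plane → Ω → ℂ)
    (x : Plane) (ω : Ω) : ℂ :=
  u x ω + (c : ℂ) * greenFn k x z

/-! ### Geometry and choice of the parameters -/

/-- The angle `ν_μ = μ π / m`. -/
def nu (m : ℕ) (μ : ℝ) : ℝ := μ * Real.pi / m

/-- The arc `∂B_j` of the circle of radius `R`. -/
def arc (R : ℝ) (m j : ℕ) : Set Plane :=
  {x | ∃ θ : ℝ, nu m (2 * (j : ℝ) - 2) ≤ θ ∧ θ ≤ nu m (2 * (j : ℝ)) ∧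
    x = !₂[R * Real.cos θ, R * Real.sin θ]}

/-- The reference point `l R (cos ν_{2j-1}, sin ν_{2j-1})`. -/
def refPoint (R : ℝ) (m j : ℕ) (l : ℝ) : Plane :=
  !₂[l * R * Real.cos (nu m (2 * (j : ℝ) - 1)), l * R * Real.sin (nu m (2 * (j : ℝ) - 1))]

/-- The small wavenumber `k* = π / (30 a)`. -/
def kStar (a : ℝ) : ℝ := Real.pi / (30 * a)

/-- The admissible set of wavenumbers. -/
def admissibleWavenumbers (a : ℝ) : Set ℝ :=
  {k | ∃ x : ℝ, 1 ≤ x ∧ k = Real.pi / a * x} ∪ {kStar a}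

/-- The choice of the parameters; `lam 0`, `lam 1` are the two ratios that place the
reference points. -/
structure ParameterChoice (a τ k R : ℝ) (m : ℕ) (lam : Fin 2 → ℝ) : Prop where
  a_pos : 0 < a
  ten_le_m : 10 ≤ m
  six_le_tau : 6 ≤ τ
  lam_zero : lam 0 = 1 / 2
  mem_admissible : k ∈ admissibleWavenumbers a
  of_ne_kStar : k ≠ kStar a → R = τ * a ∧ lam 1 = 1 / 2 + Real.pi / (2 * k * R)
  of_eq_kStar : k = kStar a → R = 6 * a ∧ lam 1 = -(3 / 2)

end PhaselessSource

end

/-! Write `u = U + iV` and `G_k(x, z_l) = p_l + i q_l`. Then `|v_l|² = |u|² + 2 (p_l U + q_l V) +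
const`, so bilinearity expresses `4 Cov(p_i U + q_i V, p_j U + q_j V)` through the phaseless
covariances (`four_mul_covariance_eq`). The pairs (1,1), (1,2), (2,2) give three linear equations
for `Var U`, `Cov(U, V)`, `Var V`, solvable as soon as `p₁ q₂ - p₂ q₁ ≠ 0` (`abs_coefficients_le`,
`second_moments_le`).

Up to a factor 1/16 and a sign, this determinant is `J₀(s) Y₀(t) - Y₀(s) J₀(t)`, where `s < t` are
the distances from `x` to the reference points, times `k`. As a function of `t` it is a nontrivial
solution of Bessel's equation vanishing at `s`. Sturm comparison (`no_two_zeros_of_bessel_system`)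
excludes another zero within `π / 2` of `s ≥ 3/10`, and the reference points are placed so that `t -
s ≤ π / 2` (`scaledDist_points`). Compactness of the range of angles bounds the constant.

Bessel's equation and the Wronskian come from the power series in `(t / 2)²`. -/

namespace PhaselessSource

/-! ### Entire power series -/

/-- The coefficient sequences of the power series that converge absolutely everywhere. -/
def IsEntireCoeff (c : ℕ → ℝ) : Prop := ∀ r : ℝ, 0 ≤ r → Summable fun p => |c p| * r ^ p

/-- One term of the binomial expansion of the right side. It trades the factor `p` produced by
differentiation for a larger radius, which is harmless for series converging at every radius. -/
theorem natCast_mul_pow_le {r : ℝ} (hr : 0 ≤ r) (p : ℕ) :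
    (p : ℝ) * r ^ (p - 1) ≤ (r + 1) ^ p := by
  induction p with
  | zero => simp
  | succ n ih =>
    have h1 : r ^ n ≤ (r + 1) ^ n := by gcongr; linarith
    have h2 : (n : ℝ) * r ^ n ≤ r * (r + 1) ^ n := by
      rcases n with _ | n
      · simp [hr]
      · have := mul_le_mul_of_nonneg_left ih hr
        simp only [Nat.add_sub_cancel] at this
        calc ((n + 1 : ℕ) : ℝ) * r ^ (n + 1) = r * (((n + 1 : ℕ) : ℝ) * r ^ n) := by ring
          _ ≤ _ := this
    simp only [Nat.add_sub_cancel]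
    push_cast
    rw [pow_succ]
    linarith

theorem IsEntireCoeff.natCast_mul {c : ℕ → ℝ} (hc : IsEntireCoeff c) :
    IsEntireCoeff fun p => (p : ℝ) * c p := by
  intro r hr
  refine Summable.of_nonneg_of_le (fun p => by positivity) (fun p => ?_)
    ((hc (r + 1) (by linarith)).mul_left r)
  rcases p with _ | p
  · simp; positivity
  · have := natCast_mul_pow_le hr (p + 1)
    simp only [Nat.add_sub_cancel] at this
    rw [abs_mul, Nat.abs_cast]
    calc ((p + 1 : ℕ) : ℝ) * |c (p + 1)| * r ^ (p + 1)
        = r * (|c (p + 1)| * (((p + 1 : ℕ) : ℝ) * r ^ p)) := by ring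
      _ ≤ r * (|c (p + 1)| * (r + 1) ^ (p + 1)) := by gcongr

theorem IsEntireCoeff.summable {c : ℕ → ℝ} (hc : IsEntireCoeff c) (x : ℝ) :
    Summable fun p => c p * x ^ p := by
  refine Summable.of_norm ?_
  simpa [abs_mul, abs_pow] using hc |x| (abs_nonneg x)

theorem IsEntireCoeff.hasDerivAt {c : ℕ → ℝ} (hc : IsEntireCoeff c) (x : ℝ) :
    HasDerivAt (fun y => ∑' p, c p * y ^ p) (∑' p, c p * ((p : ℝ) * x ^ (p - 1))) x := by
  have hx : x ∈ Metric.ball (0 : ℝ) (|x| + 1) := by simp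
  refine hasDerivAt_tsum_of_isPreconnected (u := fun p => |c p| * ((|x| + 1) + 1) ^ p)
    (hc _ (by positivity)) Metric.isOpen_ball (convex_ball _ _).isPreconnected
    (fun p y _ => (hasDerivAt_pow p y).const_mul (c p)) (fun p y hy => ?_) hx (hc.summable x) hx
  rw [Real.norm_eq_abs, abs_mul, abs_mul, abs_pow, Nat.abs_cast]
  have hy' : |y| ≤ |x| + 1 := by simpa using (Metric.mem_ball.1 hy).le
  gcongr
  exact (by gcongr : (p : ℝ) * |y| ^ (p - 1) ≤ p * (|x| + 1) ^ (p - 1)).trans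
    (natCast_mul_pow_le (by positivity) p)

theorem IsEntireCoeff.summable_deriv {c : ℕ → ℝ} (hc : IsEntireCoeff c) (x : ℝ) :
    Summable fun p : ℕ => c p * ((p : ℝ) * x ^ (p - 1)) := by
  refine Summable.of_norm_bounded (hc (|x| + 1) (by positivity)) fun p => ?_
  rw [Real.norm_eq_abs, abs_mul, abs_mul, abs_pow, Nat.abs_cast]
  gcongr
  exact natCast_mul_pow_le (by positivity) p

theorem isEntireCoeff_of_le {c : ℕ → ℝ} (h : ∀ p, |c p| ≤ 1 / p.factorial) :
    IsEntireCoeff c := fun r hr => by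
  refine Summable.of_nonneg_of_le (fun p => by positivity) (fun p => ?_)
    (Real.summable_pow_div_factorial r)
  calc |c p| * r ^ p ≤ 1 / p.factorial * r ^ p := by gcongr; exact h p
    _ = r ^ p / p.factorial := by ring

/-- If `p² c_p = d_{p-1}` for `p ≥ 1`, then `f = ∑ c_p x^p` satisfies `(x f')' = ∑ d_p x^p`. -/
theorem IsEntireCoeff.hasDerivAt_mul_deriv {c d : ℕ → ℝ} (hc : IsEntireCoeff c)
    (h : ∀ p : ℕ, ((p : ℝ) + 1) ^ 2 * c (p + 1) = d p) (x : ℝ) :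
    HasDerivAt (fun y => y * ∑' p : ℕ, c p * ((p : ℝ) * y ^ (p - 1))) (∑' p, d p * x ^ p) x := by
  have h1 := hc.natCast_mul.hasDerivAt x
  have h2 : (fun y : ℝ => y * ∑' p : ℕ, c p * ((p : ℝ) * y ^ (p - 1)))
      = fun y => ∑' p : ℕ, (p : ℝ) * c p * y ^ p := by
    funext y
    rw [← tsum_mul_left]
    refine tsum_congr fun p => ?_
    rcases p with _ | p
    · simp
    · simp only [Nat.add_sub_cancel]; ring
  have h3 : ∑' p : ℕ, (p : ℝ) * c p * ((p : ℝ) * x ^ (p - 1)) = ∑' p, d p * x ^ p := by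
    rw [(hc.natCast_mul.summable_deriv x).tsum_eq_zero_add]
    simp only [Nat.cast_zero, zero_mul, zero_add]
    refine tsum_congr fun p => ?_
    rw [← h p]
    simp only [Nat.add_sub_cancel]
    push_cast
    ring
  rw [h2, ← h3]
  exact h1

/-! ### The two series in the Bessel functions of order zero -/

/-- The coefficients of `J₀` as a power series in `(t / 2)²`. -/
noncomputable def coeffJ (p : ℕ) : ℝ := (-1 : ℝ) ^ p / ((p.factorial : ℝ) ^ 2)

/-- The coefficients of the second series in `Y₀` as a power series in `(t / 2)²`. -/
noncomputable def coeffE (p : ℕ) : ℝ := (-1 : ℝ) ^ p * ((harmonic p : ℚ) : ℝ) / ((p.factorial : ℝ) ^ 2)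

/-- `J₀` as a function of `x = (t / 2)²`. -/
noncomputable def seriesJ (x : ℝ) : ℝ := ∑' p, coeffJ p * x ^ p

/-- The second series in `Y₀` as a function of `x = (t / 2)²`. -/
noncomputable def seriesE (x : ℝ) : ℝ := ∑' p, coeffE p * x ^ p

/-- The derivative of `seriesJ`. -/
noncomputable def seriesJ' (x : ℝ) : ℝ := ∑' p : ℕ, coeffJ p * ((p : ℝ) * x ^ (p - 1))

/-- The derivative of `seriesE`. -/
noncomputable def seriesE' (x : ℝ) : ℝ := ∑' p : ℕ, coeffE p * ((p : ℝ) * x ^ (p - 1))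

theorem isEntireCoeff_coeffJ : IsEntireCoeff coeffJ := by
  refine isEntireCoeff_of_le fun p => ?_
  have h : (1 : ℝ) ≤ p.factorial := by exact_mod_cast p.factorial_pos
  rw [coeffJ, abs_div, abs_pow, abs_neg, abs_one, one_pow, abs_of_nonneg (by positivity)]
  gcongr
  nlinarith

theorem harmonic_le_factorial (p : ℕ) : harmonic p ≤ p.factorial := by
  induction p with
  | zero => simp
  | succ n ih =>
    rw [harmonic_succ, Nat.factorial_succ]
    push_cast
    have h : (1 : ℚ) ≤ n.factorial := by exact_mod_cast n.factorial_pos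
    rcases n with _ | n
    · simp
    · have h2 : ((((n + 1 : ℕ) : ℚ)) + 1)⁻¹ ≤ 1 := by
        apply inv_le_one_of_one_le₀
        push_cast; linarith [(Nat.cast_nonneg n : (0 : ℚ) ≤ n)]
      have h3 : (1 : ℚ) ≤ ((n + 1 : ℕ) : ℚ) := by push_cast; linarith [(Nat.cast_nonneg n : (0 : ℚ) ≤ n)]
      push_cast at *
      nlinarith

theorem isEntireCoeff_coeffE : IsEntireCoeff coeffE := by
  refine isEntireCoeff_of_le fun p => ?_
  have h : (0 : ℝ) < p.factorial := by exact_mod_cast p.factorial_pos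
  have h1 : ((harmonic p : ℚ) : ℝ) ≤ p.factorial := by exact_mod_cast harmonic_le_factorial p
  have h0 : (0 : ℝ) ≤ ((harmonic p : ℚ) : ℝ) := by
    have : (0 : ℚ) ≤ harmonic p := Finset.sum_nonneg fun i _ => by positivity
    exact_mod_cast this
  rw [coeffE, abs_div, abs_mul, abs_pow, abs_neg, abs_one, one_pow, one_mul, abs_of_nonneg h0,
    abs_of_nonneg (by positivity), div_le_div_iff₀ (by positivity) h]
  nlinarith

theorem hasDerivAt_seriesJ (x : ℝ) : HasDerivAt seriesJ (seriesJ' x) x :=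
  isEntireCoeff_coeffJ.hasDerivAt x

theorem hasDerivAt_seriesE (x : ℝ) : HasDerivAt seriesE (seriesE' x) x :=
  isEntireCoeff_coeffE.hasDerivAt x

theorem hasDerivAt_mul_seriesJ' (x : ℝ) :
    HasDerivAt (fun y => y * seriesJ' y) (-seriesJ x) x := by
  have h := isEntireCoeff_coeffJ.hasDerivAt_mul_deriv (d := fun p => -coeffJ p) (fun p => by
    have h : (p.factorial : ℝ) ≠ 0 := by exact_mod_cast p.factorial_ne_zero
    have h2 : (p : ℝ) + 1 ≠ 0 := by positivity
    simp only [coeffJ, Nat.factorial_succ]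
    push_cast
    field_simp
    ring) x
  have h2 : ∑' p, -coeffJ p * x ^ p = -seriesJ x := by
    rw [seriesJ, ← tsum_neg]; exact tsum_congr fun p => by ring
  rw [← h2]
  exact h

/-- The coefficient recurrence inherits `harmonic (p + 1) = harmonic p + 1 / (p + 1)`; the extra `1
/ (p + 1)` produces the forcing term `seriesJ'`. -/
theorem hasDerivAt_mul_seriesE' (x : ℝ) :
    HasDerivAt (fun y => y * seriesE' y) (seriesJ' x - seriesE x) x := by
  have h := isEntireCoeff_coeffE.hasDerivAt_mul_deriv
    (d := fun p => ((p : ℝ) + 1) * coeffJ (p + 1) - coeffE p) (fun p => by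
    have h : (p.factorial : ℝ) ≠ 0 := by exact_mod_cast p.factorial_ne_zero
    have h2 : (p : ℝ) + 1 ≠ 0 := by positivity
    simp only [coeffJ, coeffE, Nat.factorial_succ, harmonic_succ]
    push_cast
    field_simp
    ring) x
  have h2 : ∑' p : ℕ, (((p : ℝ) + 1) * coeffJ (p + 1) - coeffE p) * x ^ p
      = seriesJ' x - seriesE x := by
    have hs := isEntireCoeff_coeffJ.summable_deriv x
    have e : (fun p : ℕ => coeffJ (p + 1) * (((p + 1 : ℕ) : ℝ) * x ^ (p + 1 - 1)))
        = fun p : ℕ => ((p : ℝ) + 1) * coeffJ (p + 1) * x ^ p := by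
      funext p
      simp only [Nat.add_sub_cancel]; push_cast; ring
    have hs' := (summable_nat_add_iff 1).2 hs
    simp only [e] at hs'
    rw [seriesJ', hs.tsum_eq_zero_add, e, seriesE, Nat.cast_zero, zero_mul, mul_zero, zero_add,
      ← hs'.tsum_sub (isEntireCoeff_coeffE.summable x)]
    exact tsum_congr fun p => by ring
  rw [← h2]
  exact h

/-- The derivative cancels by the two differential equations, and the value at 0 is 1. This is `π /
2` times the Wronskian of `J₀` and `Y₀` (multiplied by `t`), from which the logarithms drop out. -/
theorem wronskian_series (x : ℝ) :
    seriesJ x ^ 2 - 2 * seriesJ x * (x * seriesE' x) + 2 * seriesE x * (x * seriesJ' x) = 1 := by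
  set K : ℝ → ℝ := fun x => seriesJ x ^ 2 - 2 * seriesJ x * (x * seriesE' x)
    + 2 * seriesE x * (x * seriesJ' x) with hK
  have hd : ∀ x, HasDerivAt K 0 x := fun x => by
    have h := (((hasDerivAt_seriesJ x).pow 2).sub (((hasDerivAt_seriesJ x).const_mul 2).mul
      (hasDerivAt_mul_seriesE' x))).add (((hasDerivAt_seriesE x).const_mul 2).mul
      (hasDerivAt_mul_seriesJ' x))
    convert! h using 1
    simp
    ring
  have h1 : K x = K 0 :=
    is_const_of_deriv_eq_zero (fun x => (hd x).differentiableAt) (fun x => (hd x).deriv) x 0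
  have h2 : K 0 = 1 := by
    have : seriesJ 0 = 1 := by
      rw [seriesJ, tsum_eq_single 0 fun p hp => by simp [hp]]
      simp [coeffJ]
    simp [hK, this]
  exact h1.trans h2

/-! ### The Bessel system -/

/-- `t J₀'(t)`. -/
noncomputable def besselPJ (t : ℝ) : ℝ := 2 * ((t / 2) ^ 2 * seriesJ' ((t / 2) ^ 2))

/-- `t Y₀'(t)`. -/
noncomputable def besselPY (t : ℝ) : ℝ :=
  2 / Real.pi * (besselPJ t * (Real.log (t / 2) + Real.eulerMascheroniConstant) + besselJ0 t)
    - 2 / Real.pi * (2 * ((t / 2) ^ 2 * seriesE' ((t / 2) ^ 2)))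

theorem besselJ0_eq (t : ℝ) : besselJ0 t = seriesJ ((t / 2) ^ 2) := by
  simp only [besselJ0, seriesJ, coeffJ, pow_mul]

theorem besselY0_eq (t : ℝ) : besselY0 t =
    2 / Real.pi * besselJ0 t * (Real.log (t / 2) + Real.eulerMascheroniConstant)
      - 2 / Real.pi * seriesE ((t / 2) ^ 2) := by
  simp only [besselY0, seriesE, coeffE, pow_mul]

theorem hasDerivAt_half_sq (t : ℝ) : HasDerivAt (fun t : ℝ => (t / 2) ^ 2) (t / 2) t := by
  have h := ((hasDerivAt_id t).div_const 2).pow 2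
  convert! h using 1
  simp
  ring

theorem hasDerivAt_besselJ0 {t : ℝ} (ht : t ≠ 0) :
    HasDerivAt besselJ0 (besselPJ t / t) t := by
  have h := (hasDerivAt_seriesJ ((t / 2) ^ 2)).comp t (hasDerivAt_half_sq t)
  rw [show besselJ0 = seriesJ ∘ fun t => (t / 2) ^ 2 from funext besselJ0_eq]
  convert! h using 1
  rw [besselPJ]
  field_simp

theorem hasDerivAt_besselPJ (t : ℝ) : HasDerivAt besselPJ (-t * besselJ0 t) t := by
  have h := ((hasDerivAt_mul_seriesJ' ((t / 2) ^ 2)).comp t (hasDerivAt_half_sq t)).const_mul 2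
  convert! h using 1
  rw [besselJ0_eq]
  ring

theorem hasDerivAt_log_half {t : ℝ} (ht : t ≠ 0) :
    HasDerivAt (fun t => Real.log (t / 2) + Real.eulerMascheroniConstant) (1 / t) t := by
  have h := (((hasDerivAt_id t).div_const 2).log (by simpa using ht)).add_const
    Real.eulerMascheroniConstant
  convert! h using 1
  simp
  field_simp

theorem hasDerivAt_besselY0 {t : ℝ} (ht : t ≠ 0) :
    HasDerivAt besselY0 (besselPY t / t) t := by
  have h := (((hasDerivAt_besselJ0 ht).const_mul (2 / Real.pi)).mul (hasDerivAt_log_half ht)).sub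
    (((hasDerivAt_seriesE ((t / 2) ^ 2)).comp t (hasDerivAt_half_sq t)).const_mul (2 / Real.pi))
  rw [show besselY0 = _ from funext besselY0_eq]
  convert! h using 1
  rw [besselPY]
  field_simp

theorem hasDerivAt_besselPY {t : ℝ} (ht : t ≠ 0) :
    HasDerivAt besselPY (-t * besselY0 t) t := by
  have h := ((((hasDerivAt_besselPJ t).mul (hasDerivAt_log_half ht)).add
    (hasDerivAt_besselJ0 ht)).const_mul (2 / Real.pi)).sub
    ((((hasDerivAt_mul_seriesE' ((t / 2) ^ 2)).comp t
      (hasDerivAt_half_sq t)).const_mul 2).const_mul (2 / Real.pi))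
  convert! h using 1
  rw [besselY0_eq, besselPJ]
  field_simp
  ring

theorem bessel_wronskian (t : ℝ) :
    besselJ0 t * besselPY t - besselY0 t * besselPJ t = 2 / Real.pi := by
  have h := wronskian_series ((t / 2) ^ 2)
  rw [besselY0_eq, besselPY, besselPJ, besselJ0_eq]
  linear_combination (2 / Real.pi) * h

/-! ### Sturm comparison -/

/-- A nontrivial solution of Bessel's equation of order zero does not vanish at both ends of an
interval that is short compared with the half period of the comparison equation
`w'' + c² w = 0`. -/
theorem no_two_zeros_of_bessel_system {z p : ℝ → ℝ} {s t c : ℝ} (hs : 0 < s) (hst : s < t)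
    (hc : 0 < c) (hcs : 1 + 1 / (4 * s ^ 2) < c ^ 2) (hlen : c * (t - s) < Real.pi)
    (hz : ∀ x ∈ Set.Icc s t, HasDerivAt z (p x / x) x)
    (hp : ∀ x ∈ Set.Icc s t, HasDerivAt p (-x * z x) x)
    (hne : ∀ x ∈ Set.Icc s t, z x ≠ 0 ∨ p x ≠ 0) (hzs : z s = 0) : z t ≠ 0 := by
  intro hzt
  -- Picone's identity for `w = √x z`, which solves `w'' + (1 + 1 / (4 x²)) w = 0`. Here `ρ` is the
  -- logarithmic derivative of `cos (c (x - (s + t) / 2))`, positive on `[s, t]`, and `h = w w' - ρ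
  -- w²` has derivative `(w' - ρ w)² + (c² - 1 - 1 / (4 x²)) w² > 0`, yet would vanish at both ends.
  set ρ : ℝ → ℝ := fun x => -(c * Real.tan (c * (x - (s + t) / 2))) with hρ
  set h : ℝ → ℝ := fun x => z x * p x + z x ^ 2 / 2 - ρ x * x * z x ^ 2 with hh
  have hρd : ∀ x ∈ Set.Icc s t, HasDerivAt ρ (-(c ^ 2 + ρ x ^ 2)) x := by
    intro x hx
    have hcos : Real.cos (c * (x - (s + t) / 2)) ≠ 0 := by
      refine (Real.cos_pos_of_mem_Ioo ⟨?_, ?_⟩).ne' <;> nlinarith [hx.1, hx.2]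
    have h1 : HasDerivAt (fun x => c * (x - (s + t) / 2)) c x := by
      simpa using ((hasDerivAt_id x).sub_const ((s + t) / 2)).const_mul c
    have h2 := (((Real.hasDerivAt_tan hcos).comp x h1).const_mul c).neg
    convert! h2 using 1
    simp only [hρ]
    rw [Real.tan_eq_sin_div_cos]
    generalize c * (x - (s + t) / 2) = α at hcos ⊢
    field_simp
    linear_combination -Real.sin_sq_add_cos_sq α
  have hhd : ∀ x ∈ Set.Icc s t, HasDerivAt h (1 / x * (p x + z x / 2 - ρ x * x * z x) ^ 2
      + x * z x ^ 2 * (c ^ 2 - 1 - 1 / (4 * x ^ 2))) x := by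
    intro x hx
    have hx0 : x ≠ 0 := (hs.trans_le hx.1).ne'
    have := (((hz x hx).mul (hp x hx)).add (((hz x hx).pow 2).div_const 2)).sub
      (((hρd x hx).mul (hasDerivAt_id x)).mul ((hz x hx).pow 2))
    convert! this using 1
    simp
    field_simp
    ring
  have hmono : StrictMonoOn h (Set.Icc s t) := by
    refine strictMonoOn_of_deriv_pos (convex_Icc s t)
      (fun x hx => (hhd x hx).continuousAt.continuousWithinAt) fun x hx => ?_
    rw [interior_Icc] at hx
    have hx' := Set.Ioo_subset_Icc_self hx
    have hx0 : 0 < x := hs.trans hx.1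
    rw [(hhd x hx').deriv]
    have hq : 0 < c ^ 2 - 1 - 1 / (4 * x ^ 2) := by
      have : 1 / (4 * x ^ 2) ≤ 1 / (4 * s ^ 2) := by
        have := hx.1.le
        gcongr
      linarith
    by_cases hzx : z x = 0
    · have hpx := (hne x hx').resolve_left (not_not.2 hzx)
      simp only [hzx]
      have : 0 < p x ^ 2 := by positivity
      simp only [zero_div, mul_zero, add_zero, sub_zero]
      positivity
    · have : 0 < z x ^ 2 := by positivity
      positivity
  have := hmono (Set.left_mem_Icc.2 hst.le) (Set.right_mem_Icc.2 hst.le) hst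
  simp [hh, hzs, hzt] at this

/-- The cross product of the Bessel functions does not vanish at two points at distance at most
`π / 2`, away from the origin. -/
theorem bessel_cross_ne_zero {s t : ℝ} (hs : 3 / 10 ≤ s) (hst : s < t)
    (hlen : t - s ≤ Real.pi / 2) :
    besselJ0 s * besselY0 t - besselY0 s * besselJ0 t ≠ 0 := by
  have hW := bessel_wronskian
  have hpi := Real.pi_pos
  have hW0 : (2 / Real.pi : ℝ) ≠ 0 := by positivity
  -- The value `39/20` lies below 2, so that `c π / 2 < π`, while its square exceeds `1 + 25/9`, the
  -- bound needed at `s = 3/10`.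
  refine no_two_zeros_of_bessel_system (c := 39 / 20)
    (z := fun x => besselJ0 s * besselY0 x - besselY0 s * besselJ0 x)
    (p := fun x => besselJ0 s * besselPY x - besselY0 s * besselPJ x)
    (by linarith) hst (by norm_num) ?_ (by linarith) ?_ ?_ ?_ (by ring)
  · have : 1 / (4 * s ^ 2) ≤ 1 / (4 * (3 / 10) ^ 2) := by gcongr
    norm_num at this ⊢
    linarith
  · intro x hx
    have hx0 : x ≠ 0 := by linarith [hx.1]
    convert! ((hasDerivAt_besselY0 hx0).const_mul (besselJ0 s)).sub
      ((hasDerivAt_besselJ0 hx0).const_mul (besselY0 s)) using 1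
    ring
  · intro x hx
    have hx0 : x ≠ 0 := by linarith [hx.1]
    convert! ((hasDerivAt_besselPY hx0).const_mul (besselJ0 s)).sub
      ((hasDerivAt_besselPJ x).const_mul (besselY0 s)) using 1
    ring
  · intro x _
    by_contra! hcon
    obtain ⟨h1, h2⟩ := hcon
    have hJ : besselJ0 s = 0 := by
      have : besselJ0 s * (2 / Real.pi) = 0 := by
        rw [← hW x]; linear_combination besselJ0 x * h2 - besselPJ x * h1
      exact (mul_eq_zero.1 this).resolve_right hW0
    have hY : besselY0 s = 0 := by
      have : besselY0 s * (2 / Real.pi) = 0 := by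
        rw [← hW x]; linear_combination besselY0 x * h2 - besselPY x * h1
      exact (mul_eq_zero.1 this).resolve_right hW0
    have := hW s
    rw [hJ, hY, zero_mul, zero_mul, sub_zero] at this
    exact hW0 this.symm

end PhaselessSource

namespace PhaselessSource

/-! ### The phase retrieval system for the second moments -/

theorem memLp_two_sq {Ω : Type*} [MeasurableSpace Ω] {P : Measure Ω} {U : Ω → ℝ}
    (hU : MemLp U 4 P) : MemLp (fun ω => U ω ^ 2) 2 P := by
  have : ENNReal.HolderTriple 4 4 2 := ⟨by
    rw [← two_mul, show (4 : ENNReal) = 2 * 2 by norm_num,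
      ENNReal.mul_inv (by simp) (by simp), ← mul_assoc, ENNReal.mul_inv_cancel (by simp) (by simp),
      one_mul]⟩
  have := hU.mul (r := 2) hU
  simpa only [sq] using! this

/-- The values of a quadratic form in two variables at two independent vectors, together with the
value of its polar form, control its coefficients. -/
theorem abs_coefficients_le {A B D p₁ q₁ p₂ q₂ e : ℝ} (hΔ : p₁ * q₂ - p₂ * q₁ ≠ 0)
    (h₁ : |p₁ * p₁ * A + (p₁ * q₁ + p₁ * q₁) * B + q₁ * q₁ * D| ≤ e)
    (h₁₂ : |p₁ * p₂ * A + (p₁ * q₂ + p₂ * q₁) * B + q₁ * q₂ * D| ≤ e)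
    (h₂ : |p₂ * p₂ * A + (p₂ * q₂ + p₂ * q₂) * B + q₂ * q₂ * D| ≤ e) :
    |A| + |B| + |D| ≤
      3 * (p₁ ^ 2 + q₁ ^ 2 + p₂ ^ 2 + q₂ ^ 2) / (p₁ * q₂ - p₂ * q₁) ^ 2 * e := by
  set E₁ := p₁ * p₁ * A + (p₁ * q₁ + p₁ * q₁) * B + q₁ * q₁ * D with hE₁
  set E₁₂ := p₁ * p₂ * A + (p₁ * q₂ + p₂ * q₁) * B + q₁ * q₂ * D with hE₁₂
  set E₂ := p₂ * p₂ * A + (p₂ * q₂ + p₂ * q₂) * B + q₂ * q₂ * D with hE₂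
  set Δ := p₁ * q₂ - p₂ * q₁ with hΔd
  have hΔ2 : 0 < Δ ^ 2 := by positivity
  have he : 0 ≤ e := (abs_nonneg _).trans h₁
  have key : ∀ a b c F : ℝ, Δ ^ 2 * F = a * E₁ + b * E₁₂ + c * E₂ →
      Δ ^ 2 * |F| ≤ (|a| + |b| + |c|) * e := by
    intro a b c F h
    calc Δ ^ 2 * |F| = |a * E₁ + b * E₁₂ + c * E₂| := by rw [← h, abs_mul, abs_of_pos hΔ2]
      _ ≤ |a * E₁| + |b * E₁₂| + |c * E₂| := abs_add_three _ _ _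
      _ = |a| * |E₁| + |b| * |E₁₂| + |c| * |E₂| := by simp only [abs_mul]
      _ ≤ |a| * e + |b| * e + |c| * e := by gcongr
      _ = _ := by ring
  have amgm : ∀ x y : ℝ, |x * y| ≤ (x ^ 2 + y ^ 2) / 2 := fun x y =>
    abs_le.2 ⟨by nlinarith [sq_nonneg (x + y)], by nlinarith [sq_nonneg (x - y)]⟩
  -- The explicit inverse of the symmetric square of a 2 × 2 matrix: only `Δ²` enters the
  -- denominator.
  have hA := key (q₂ ^ 2) (-(2 * (q₁ * q₂))) (q₁ ^ 2) A (by rw [hE₁, hE₁₂, hE₂, hΔd]; ring)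
  have hB := key (-(p₂ * q₂)) (p₁ * q₂ + q₁ * p₂) (-(p₁ * q₁)) B
    (by rw [hE₁, hE₁₂, hE₂, hΔd]; ring)
  have hD := key (p₂ ^ 2) (-(2 * (p₁ * p₂))) (p₁ ^ 2) D (by rw [hE₁, hE₁₂, hE₂, hΔd]; ring)
  rw [abs_neg, abs_mul 2, abs_two, abs_pow, abs_pow, sq_abs, sq_abs] at hA hD
  rw [abs_neg, abs_neg] at hB
  have hA' : Δ ^ 2 * |A| ≤ 2 * (q₁ ^ 2 + q₂ ^ 2) * e :=
    hA.trans (mul_le_mul_of_nonneg_right (by linarith [amgm q₁ q₂]) he)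
  have hB' : Δ ^ 2 * |B| ≤ (p₁ ^ 2 + q₁ ^ 2 + p₂ ^ 2 + q₂ ^ 2) * e :=
    hB.trans (mul_le_mul_of_nonneg_right (by
      linarith [amgm p₂ q₂, amgm p₁ q₁, amgm p₁ q₂, amgm q₁ p₂,
        abs_add_le (p₁ * q₂) (q₁ * p₂)]) he)
  have hD' : Δ ^ 2 * |D| ≤ 2 * (p₁ ^ 2 + p₂ ^ 2) * e :=
    hD.trans (mul_le_mul_of_nonneg_right (by linarith [amgm p₁ p₂]) he)
  rw [div_mul_eq_mul_div, le_div_iff₀ hΔ2]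
  linarith

section Covariance

variable {Ω : Type*} [MeasurableSpace Ω] {P : Measure Ω} [IsProbabilityMeasure P]

theorem covariance_add_two_mul_add_const {X Q L : Ω → ℝ} (hX : MemLp X 2 P) (hQ : MemLp Q 2 P)
    (hL : MemLp L 2 P) (c : ℝ) :
    cov[X, fun ω => Q ω + 2 * L ω + c; P] = cov[X, Q; P] + 2 * cov[X, L; P] := by
  have hL' : MemLp (fun ω => 2 * L ω) 2 P := hL.const_mul 2
  have hQL : Integrable (fun ω => Q ω + 2 * L ω) P := (hQ.add hL').integrable (by norm_num)
  rw [covariance_add_const_right hQL c, ← covariance_const_mul_right]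
  exact covariance_add_right hX hQ hL'

/-- Bilinearity; the covariances with `Q` and the variance are combined so that the unknown terms
`Cov(Q, L_i)` cancel. -/
theorem four_mul_covariance_eq {Q L₁ L₂ : Ω → ℝ} (hQ : MemLp Q 2 P) (h₁ : MemLp L₁ 2 P)
    (h₂ : MemLp L₂ 2 P) (c₁ c₂ : ℝ) :
    4 * cov[L₁, L₂; P] =
      cov[fun ω => Q ω + 2 * L₁ ω + c₁, fun ω => Q ω + 2 * L₂ ω + c₂; P]
        - cov[Q, fun ω => Q ω + 2 * L₁ ω + c₁; P] - cov[Q, fun ω => Q ω + 2 * L₂ ω + c₂; P]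
        + Var[Q; P] := by
  have hV : MemLp (fun ω => Q ω + 2 * L₁ ω + c₁) 2 P :=
    (hQ.add (h₁.const_mul 2)).add (memLp_const c₁)
  rw [covariance_add_two_mul_add_const hV hQ h₂, covariance_add_two_mul_add_const hQ hQ h₁,
    covariance_add_two_mul_add_const hQ hQ h₂, covariance_comm _ Q,
    covariance_add_two_mul_add_const hQ hQ h₁, covariance_comm (fun ω => Q ω + 2 * L₁ ω + c₁) L₂,
    covariance_add_two_mul_add_const h₂ hQ h₁, covariance_self hQ.aestronglyMeasurable.aemeasurable,
    covariance_comm L₂ Q, covariance_comm L₂ L₁]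
  ring

theorem covariance_linear_combination {U V : Ω → ℝ} (hU : MemLp U 2 P) (hV : MemLp V 2 P)
    (p₁ q₁ p₂ q₂ : ℝ) :
    cov[fun ω => p₁ * U ω + q₁ * V ω, fun ω => p₂ * U ω + q₂ * V ω; P] =
      p₁ * p₂ * Var[U; P] + (p₁ * q₂ + p₂ * q₁) * cov[U, V; P] + q₁ * q₂ * Var[V; P] := by
  have hadd : ∀ {X : Ω → ℝ}, MemLp X 2 P → ∀ p q : ℝ,
      cov[X, fun ω => p * U ω + q * V ω; P] = p * cov[X, U; P] + q * cov[X, V; P] := by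
    intro X hX p q
    rw [← covariance_const_mul_right, ← covariance_const_mul_right]
    exact covariance_add_right hX (hU.const_mul p) (hV.const_mul q)
  have hL : MemLp (fun ω => p₁ * U ω + q₁ * V ω) 2 P := (hU.const_mul p₁).add (hV.const_mul q₁)
  rw [hadd hL, covariance_comm _ U, covariance_comm _ V, hadd hU, hadd hV,
    covariance_self hU.aestronglyMeasurable.aemeasurable,
    covariance_self hV.aestronglyMeasurable.aemeasurable, covariance_comm V U]
  ring

/-- Recovery of the second moments of a complex random variable from the phaseless second moments
of the variable and of two translates. -/
theorem second_moments_le {X : Ω → ℂ} (hU : MemLp (fun ω => (X ω).re) 4 P)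
    (hV : MemLp (fun ω => (X ω).im) 4 P) (z : Fin 2 → ℂ)
    (hΔ : (z 0).re * (z 1).im - (z 1).re * (z 0).im ≠ 0) :
    |Var[fun ω => (X ω).re; P]| + |cov[fun ω => (X ω).re, fun ω => (X ω).im; P]|
        + |Var[fun ω => (X ω).im; P]|
      ≤ ((z 0).re ^ 2 + (z 0).im ^ 2 + (z 1).re ^ 2 + (z 1).im ^ 2)
          / ((z 0).re * (z 1).im - (z 1).re * (z 0).im) ^ 2 *
        ∑ l₁ : Fin 2, ∑ l₂ ∈ Finset.Ici l₁,
          (|cov[fun ω => ‖X ω + z l₁‖ ^ 2, fun ω => ‖X ω + z l₂‖ ^ 2; P]|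
            + |cov[fun ω => ‖X ω‖ ^ 2, fun ω => ‖X ω + z l₁‖ ^ 2; P]|
            + |cov[fun ω => ‖X ω‖ ^ 2, fun ω => ‖X ω + z l₂‖ ^ 2; P]|
            + |Var[fun ω => ‖X ω‖ ^ 2; P]|) := by
  set T : Fin 2 → Fin 2 → ℝ := fun l₁ l₂ =>
    |cov[fun ω => ‖X ω + z l₁‖ ^ 2, fun ω => ‖X ω + z l₂‖ ^ 2; P]|
      + |cov[fun ω => ‖X ω‖ ^ 2, fun ω => ‖X ω + z l₁‖ ^ 2; P]|
      + |cov[fun ω => ‖X ω‖ ^ 2, fun ω => ‖X ω + z l₂‖ ^ 2; P]|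
      + |Var[fun ω => ‖X ω‖ ^ 2; P]| with hT
  have hT0 : ∀ i j, 0 ≤ T i j := fun i j => by simp only [hT]; positivity
  have hU2 : MemLp (fun ω => (X ω).re) 2 P := hU.mono_exponent (by norm_num)
  have hV2 : MemLp (fun ω => (X ω).im) 2 P := hV.mono_exponent (by norm_num)
  have hQ : MemLp (fun ω => ‖X ω‖ ^ 2) 2 P := by
    simp only [Complex.sq_norm, Complex.normSq_apply, ← sq]
    exact (memLp_two_sq hU).add (memLp_two_sq hV)
  have hexp : ∀ l, (fun ω => ‖X ω + z l‖ ^ 2) = fun ω => ‖X ω‖ ^ 2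
      + 2 * ((z l).re * (X ω).re + (z l).im * (X ω).im) + ‖z l‖ ^ 2 := fun l => by
    funext ω
    simp only [Complex.sq_norm, Complex.normSq_apply, Complex.add_re, Complex.add_im]
    ring
  have hT4 : ∀ i j, |(z i).re * (z j).re * Var[fun ω => (X ω).re; P]
      + ((z i).re * (z j).im + (z j).re * (z i).im)
        * cov[fun ω => (X ω).re, fun ω => (X ω).im; P]
      + (z i).im * (z j).im * Var[fun ω => (X ω).im; P]| ≤ T i j / 4 := by
    intro i j
    have hL : ∀ l, MemLp (fun ω => (z l).re * (X ω).re + (z l).im * (X ω).im) 2 P := fun l =>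
      (hU2.const_mul _).add (hV2.const_mul _)
    have h4 := four_mul_covariance_eq hQ (hL i) (hL j) (‖z i‖ ^ 2) (‖z j‖ ^ 2)
    rw [← hexp, ← hexp] at h4
    rw [← covariance_linear_combination hU2 hV2, le_div_iff₀ (by norm_num), mul_comm,
      ← abs_of_pos (show (0 : ℝ) < 4 by norm_num), ← abs_mul, h4]
    refine (abs_add_le _ _).trans (add_le_add_left ((abs_sub _ _).trans
      (add_le_add_left (abs_sub _ _) _)) _)
  have hsum : ∑ l₁ : Fin 2, ∑ l₂ ∈ Finset.Ici l₁, T l₁ l₂ = T 0 0 + T 0 1 + T 1 1 := by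
    rw [Fin.sum_univ_two, show Finset.Ici (0 : Fin 2) = {0, 1} by decide,
      show Finset.Ici (1 : Fin 2) = {1} by decide]
    simp
  change _ ≤ _ * ∑ l₁ : Fin 2, ∑ l₂ ∈ Finset.Ici l₁, T l₁ l₂
  rw [hsum]
  set S := T 0 0 + T 0 1 + T 1 1 with hS
  have hS0 : 0 ≤ S := by linarith [hT0 0 0, hT0 0 1, hT0 1 1]
  -- The 4 is that of `4 Cov`; it absorbs the 3 in `abs_coefficients_le`.
  refine (abs_coefficients_le hΔ (e := S / 4)
    ((hT4 0 0).trans (by linarith [hT0 0 1, hT0 1 1]))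
    ((hT4 0 1).trans (by linarith [hT0 0 0, hT0 1 1]))
    ((hT4 1 1).trans (by linarith [hT0 0 0, hT0 0 1]))).trans ?_
  have : 0 ≤ ((z 0).re ^ 2 + (z 0).im ^ 2 + (z 1).re ^ 2 + (z 1).im ^ 2)
          / ((z 0).re * (z 1).im - (z 1).re * (z 0).im) ^ 2 * S := by positivity
  rw [mul_div_assoc]
  linarith

/-! ### Moments of the wave field -/

theorem memLp_wienerIntegral {W : Lp ℝ 2 (volume : Measure Plane) → Ω → ℝ}
    (hW : IsWhiteNoise P W) (f : Plane → ℝ) : MemLp (wienerIntegral W f) 4 P := by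
  by_cases hf : MemLp f 2 (volume : Measure Plane)
  · have : wienerIntegral W f = W (hf.toLp f) := by
      funext ω; simp [wienerIntegral, hf]
    rw [this]
    exact (hW.gaussian.hasGaussianLaw_eval _).memLp (by norm_num)
  · have : wienerIntegral W f = fun _ => 0 := by
      funext ω; simp [wienerIntegral, hf]
    rw [this]
    exact memLp_const 0

/-- Almost surely each part is a constant plus a Wiener integral, which is Gaussian or the default
0. Fourth moments make `|u|²` square integrable, so its covariances expand bilinearly. -/
theorem IsMildSolution.memLp {W : Lp ℝ 2 (volume : Measure Plane) → Ω → ℝ}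
    (hW : IsWhiteNoise P W) {a k : ℝ} {g σ : Plane → ℝ} {u : Plane → Ω → ℂ}
    (hu : IsMildSolution P W a k g σ u) (x : Plane) :
    MemLp (fun ω => (u x ω).re) 4 P ∧ MemLp (fun ω => (u x ω).im) 4 P := by
  set c := ∫ y in sourceSquare a, greenFn k x y * (g y : ℂ)
  set f := (sourceSquare a).indicator fun y => greenFn k x y * (σ y : ℂ)
  have h := hu.eq_integral x
  constructor
  · refine MemLp.ae_eq ?_ ((memLp_const c.re).add (memLp_wienerIntegral hW fun y => (f y).re))
    filter_upwards [h] with ω hω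
    rw [hω]
    simp [wienerIntegralC, c, f]
  · refine MemLp.ae_eq ?_ ((memLp_const c.im).add (memLp_wienerIntegral hW fun y => (f y).im))
    filter_upwards [h] with ω hω
    rw [hω]
    simp [wienerIntegralC, c, f]

end Covariance

end PhaselessSource

namespace PhaselessSource

/-! ### Geometry of the arcs and the reference points -/

/-- `k` times the distance between a point of the circle of radius `R` and the reference point
with ratio `l`, seen from the centre under the angle `φ`, where `κ = k R`. -/
noncomputable def scaledDist (κ l φ : ℝ) : ℝ := κ * √(1 + l ^ 2 - 2 * l * Real.cos φ)

theorem mul_norm_sub_refPoint {R : ℝ} (hR : 0 ≤ R) (k θ l : ℝ) (m j : ℕ) :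
    k * ‖(!₂[R * Real.cos θ, R * Real.sin θ] : Plane) - refPoint R m j l‖
      = scaledDist (k * R) l (θ - nu m (2 * (j : ℝ) - 1)) := by
  rw [EuclideanSpace.norm_eq, Fin.sum_univ_two, scaledDist, mul_assoc]
  congr 1
  rw [← Real.sqrt_sq hR, ← Real.sqrt_mul (sq_nonneg R), Real.sqrt_sq hR]
  congr 1
  simp only [refPoint, Real.norm_eq_abs, sq_abs, PiLp.sub_apply, Matrix.cons_val_zero,
    Matrix.cons_val_one]
  generalize nu m (2 * (j : ℝ) - 1) = ν
  rw [Real.cos_sub]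
  linear_combination R ^ 2 * Real.sin_sq_add_cos_sq θ + l ^ 2 * R ^ 2 * Real.sin_sq_add_cos_sq ν

theorem greenFn_re_im (k : ℝ) (x y : Plane) :
    (greenFn k x y).re = besselY0 (k * ‖x - y‖) / 4 ∧
      (greenFn k x y).im = -(besselJ0 (k * ‖x - y‖) / 4) := by
  constructor <;> simp [greenFn, hankelH0] <;> ring

theorem ParameterChoice.pos {a τ k R : ℝ} {m : ℕ} {lam : Fin 2 → ℝ}
    (h : ParameterChoice a τ k R m lam) : 0 < k ∧ 0 < R := by
  have ha := h.a_pos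
  have hτ := h.six_le_tau
  constructor
  · rcases h.mem_admissible with ⟨x, hx, rfl⟩ | hk
    · have := Real.pi_pos; positivity
    · rw [Set.mem_singleton_iff.1 hk, kStar]; have := Real.pi_pos; positivity
  · by_cases hk : k = kStar a
    · rw [(h.of_eq_kStar hk).1]; positivity
    · rw [(h.of_ne_kStar hk).1]; positivity

/-- For `k = k*`, `κ = k R = π / 5` and the distances lie between `R / 2` and `5 R / 2`, so both
scaled distances lie in `[π / 10, π / 2]`. Otherwise the reference points are on one ray at distance
`δ R` with `κ δ = π / 2`, and the triangle inequality applies; the second is the nearer one, because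
`1/2 < lam 1 < cos φ`. -/
theorem scaledDist_points {a τ k R : ℝ} {m : ℕ} {lam : Fin 2 → ℝ}
    (h : ParameterChoice a τ k R m lam) {φ : ℝ} (hφ : φ ∈ Set.Icc (-(Real.pi / 10)) (Real.pi / 10)) :
    ∃ s t, 3 / 10 ≤ s ∧ s < t ∧ t - s ≤ Real.pi / 2 ∧
      ((scaledDist (k * R) (lam 0) φ = s ∧ scaledDist (k * R) (lam 1) φ = t) ∨
        (scaledDist (k * R) (lam 0) φ = t ∧ scaledDist (k * R) (lam 1) φ = s)) := by
  have hpi := Real.pi_gt_three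
  have hpi' := Real.pi_lt_d2
  have ha := h.a_pos
  have hτ := h.six_le_tau
  have hC1 := Real.cos_le_one φ
  have hC : 19 / 20 ≤ Real.cos φ := by
    have h1 := Real.one_sub_sq_div_two_le_cos (x := φ)
    have h2 : φ ^ 2 ≤ (Real.pi / 10) ^ 2 := sq_le_sq' hφ.1 hφ.2
    nlinarith
  set C := Real.cos φ with hCd
  have hl0 := h.lam_zero
  simp only [scaledDist, ← hCd, hl0]
  by_cases hk : k = kStar a
  · obtain ⟨hR, hl1⟩ := h.of_eq_kStar hk
    have hκ : k * R = Real.pi / 5 := by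
      rw [hk, hR, kStar]; field_simp; norm_num
    have h1 : (1 : ℝ) / 2 ≤ √(1 + (1 / 2) ^ 2 - 2 * (1 / 2) * C) :=
      Real.le_sqrt_of_sq_le (by linarith)
    have h2 : √(1 + (-(3 / 2)) ^ 2 - 2 * (-(3 / 2)) * C) ≤ 5 / 2 :=
      Real.sqrt_le_iff.2 ⟨by norm_num, by linarith⟩
    have hlt : √(1 + (1 / 2) ^ 2 - 2 * (1 / 2) * C) < √(1 + (-(3 / 2)) ^ 2 - 2 * (-(3 / 2)) * C) :=
      Real.sqrt_lt_sqrt (by linarith) (by linarith)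
    refine ⟨_, _, ?_, ?_, ?_, Or.inl ⟨rfl, rfl⟩⟩ <;> rw [hκ] <;> try rw [hl1]
    · nlinarith
    · exact mul_lt_mul_of_pos_left hlt (by positivity)
    · nlinarith
  · obtain ⟨hR, hl1⟩ := h.of_ne_kStar hk
    obtain ⟨y, hy, hky⟩ : ∃ y : ℝ, 1 ≤ y ∧ k = Real.pi / a * y :=
      h.mem_admissible.resolve_right hk
    set κ := k * R with hκd
    have hκ : 6 * Real.pi ≤ κ := by
      have : κ = Real.pi * (y * τ) := by rw [hκd, hky, hR]; field_simp
      have hyτ : 6 ≤ y * τ := by nlinarith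
      rw [this]
      nlinarith
    have hκ0 : 0 < κ := by linarith
    set δ := Real.pi / (2 * κ) with hδd
    have hδκ : κ * δ = Real.pi / 2 := by rw [hδd]; field_simp
    have hl1' : lam 1 = 1 / 2 + δ := by rw [hl1, hδd, hκd, mul_assoc]
    have hδ0 : 0 < δ := by positivity
    have hδ : δ ≤ 1 / 12 := by
      rw [hδd, div_le_iff₀ (by positivity)]; linarith
    rw [hl1']
    set A := √(1 + (1 / 2) ^ 2 - 2 * (1 / 2) * C) with hA
    set B := √(1 + (1 / 2 + δ) ^ 2 - 2 * (1 / 2 + δ) * C) with hB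
    have hBsq : B ^ 2 = 1 + (1 / 2 + δ) ^ 2 - 2 * (1 / 2 + δ) * C :=
      Real.sq_sqrt (by nlinarith)
    -- Projection onto the ray of the reference points. It serves both the triangle inequality `A ≤
    -- B + δ` and the lower bound `B ≥ 19/20 - 7/12 > 1/3`.
    have hB1 : C - 1 / 2 - δ ≤ B := Real.le_sqrt_of_sq_le (by nlinarith)
    have hBA : B < A := Real.sqrt_lt_sqrt (by nlinarith) (by nlinarith)
    have hAB : A ≤ B + δ := Real.sqrt_le_iff.2 ⟨by positivity, by nlinarith⟩
    refine ⟨κ * B, κ * A, ?_, ?_, ?_, Or.inr ⟨rfl, rfl⟩⟩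
    · calc (3 / 10 : ℝ) ≤ 18 * (1 / 3) := by norm_num
        _ ≤ κ * B := mul_le_mul (by linarith) (by linarith) (by norm_num) hκ0.le
    · exact mul_lt_mul_of_pos_left hBA hκ0
    · rw [← hδκ, ← mul_sub]
      exact mul_le_mul_of_nonneg_left (by linarith) hκ0.le

/-! ### Uniform bound for the stability constant -/

theorem continuousAt_besselJ0 {t : ℝ} (ht : t ≠ 0) : ContinuousAt besselJ0 t :=
  (hasDerivAt_besselJ0 ht).continuousAt

theorem continuousAt_besselY0 {t : ℝ} (ht : t ≠ 0) : ContinuousAt besselY0 t :=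
  (hasDerivAt_besselY0 ht).continuousAt

/-- The stability constant at the angle `φ`, as a function of the scaled distances. -/
noncomputable def stabilityRatio (s t : ℝ) : ℝ :=
  ((besselY0 s / 4) ^ 2 + (-(besselJ0 s / 4)) ^ 2 + (besselY0 t / 4) ^ 2
    + (-(besselJ0 t / 4)) ^ 2)
    / (besselY0 s / 4 * -(besselJ0 t / 4) - besselY0 t / 4 * -(besselJ0 s / 4)) ^ 2

theorem cross_ne_zero {a τ k R : ℝ} {m : ℕ} {lam : Fin 2 → ℝ}
    (h : ParameterChoice a τ k R m lam) {φ : ℝ} (hφ : φ ∈ Set.Icc (-(Real.pi / 10)) (Real.pi / 10)) :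
    besselY0 (scaledDist (k * R) (lam 0) φ) / 4 * -(besselJ0 (scaledDist (k * R) (lam 1) φ) / 4)
      - besselY0 (scaledDist (k * R) (lam 1) φ) / 4
        * -(besselJ0 (scaledDist (k * R) (lam 0) φ) / 4) ≠ 0 := by
  obtain ⟨s, t, hs, hst, hlen, h⟩ := scaledDist_points h hφ
  have hne := bessel_cross_ne_zero hs hst hlen
  rcases h with ⟨h0, h1⟩ | ⟨h0, h1⟩ <;> rw [h0, h1] <;> contrapose! hne
  · linear_combination 16 * hne
  · linear_combination -16 * hne

/-- The stability constant is bounded over the arc, uniformly in all the parameters other than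
`k`, `R` and the second ratio. -/
theorem exists_stability_bound (k R l : ℝ) :
    ∃ C : ℝ, ∀ (a τ : ℝ) (m : ℕ) (lam : Fin 2 → ℝ), ParameterChoice a τ k R m lam → lam 1 = l →
      ∀ φ ∈ Set.Icc (-(Real.pi / 10)) (Real.pi / 10),
        stabilityRatio (scaledDist (k * R) (lam 0) φ) (scaledDist (k * R) (lam 1) φ) ≤ C := by
  -- Since `lam 0 = 1 / 2` always, the ratio is a function of `k`, `R`, `l`, `φ` alone. One
  -- admissible choice therefore yields continuity in `φ`, and the resulting bound holds for all
  -- choices with the same `k`, `R`, `l`.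
  by_cases hex : ∃ (a τ : ℝ) (m : ℕ) (lam : Fin 2 → ℝ), ParameterChoice a τ k R m lam ∧ lam 1 = l
  · obtain ⟨a, τ, m, lam, h, hl⟩ := hex
    have hcont : ContinuousOn (fun φ => stabilityRatio (scaledDist (k * R) (lam 0) φ)
        (scaledDist (k * R) (lam 1) φ)) (Set.Icc (-(Real.pi / 10)) (Real.pi / 10)) := by
      intro φ hφ
      refine ContinuousAt.continuousWithinAt ?_
      have hd : ∀ l, ContinuousAt (scaledDist (k * R) l) φ := fun l => by
        unfold scaledDist; fun_prop
      have hpos : scaledDist (k * R) (lam 0) φ ≠ 0 ∧ scaledDist (k * R) (lam 1) φ ≠ 0 := by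
        obtain ⟨s, t, hs, hst, -, ⟨h0, h1⟩ | ⟨h0, h1⟩⟩ := scaledDist_points h hφ <;>
          rw [h0, h1] <;> constructor <;> linarith
      have hJ0 := (continuousAt_besselJ0 hpos.1).comp (hd (lam 0))
      have hY0 := (continuousAt_besselY0 hpos.1).comp (hd (lam 0))
      have hJ1 := (continuousAt_besselJ0 hpos.2).comp (hd (lam 1))
      have hY1 := (continuousAt_besselY0 hpos.2).comp (hd (lam 1))
      simp only [Function.comp_def] at hJ0 hY0 hJ1 hY1
      unfold stabilityRatio
      exact ContinuousAt.div (by fun_prop) (by fun_prop) (pow_ne_zero 2 (cross_ne_zero h hφ))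
    obtain ⟨C, hC⟩ := isCompact_Icc.bddAbove_image hcont
    refine ⟨C, fun a' τ' m' lam' h' hl' φ hφ => ?_⟩
    rw [h'.lam_zero, hl', ← hl, ← h.lam_zero]
    exact hC ⟨φ, hφ, rfl⟩
  · exact ⟨0, fun a τ m lam h hl => absurd ⟨a, τ, m, lam, h, hl⟩ hex⟩

theorem angle_mem {m j : ℕ} (hm : 10 ≤ m) {θ : ℝ} (h1 : nu m (2 * (j : ℝ) - 2) ≤ θ)
    (h2 : θ ≤ nu m (2 * (j : ℝ))) :
    θ - nu m (2 * (j : ℝ) - 1) ∈ Set.Icc (-(Real.pi / 10)) (Real.pi / 10) := by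
  have hm' : (10 : ℝ) ≤ m := by exact_mod_cast hm
  have hpi : Real.pi / m ≤ Real.pi / 10 :=
    div_le_div_of_nonneg_left Real.pi_pos.le (by norm_num) hm'
  have e1 : nu m (2 * (j : ℝ) - 2) = nu m (2 * (j : ℝ) - 1) - Real.pi / m := by
    unfold nu; ring
  have e2 : nu m (2 * (j : ℝ)) = nu m (2 * (j : ℝ) - 1) + Real.pi / m := by
    unfold nu; ring
  constructor <;> linarith

end PhaselessSource
-- The stability estimate
theorem theorem2p4 :
    ∃ C : ℝ → ℝ → ℝ → ℝ → ℝ → ℝ,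
      ∀ (a τ k R : ℝ) (m : ℕ) (lam : Fin 2 → ℝ),
        PhaselessSource.ParameterChoice a τ k R m lam →
      ∀ (Ω : Type*) [MeasurableSpace Ω] (P : Measure Ω) [IsProbabilityMeasure P]
        (W : Lp ℝ 2 (volume : Measure PhaselessSource.Plane) → Ω → ℝ)
        (g σ : PhaselessSource.Plane → ℝ) (u : PhaselessSource.Plane → Ω → ℂ),
        PhaselessSource.IsWhiteNoise P W →
        HasCompactSupport g → tsupport g ⊆ PhaselessSource.sourceSquare a →
        HasCompactSupport σ → tsupport σ ⊆ PhaselessSource.sourceSquare a →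
        (∀ y, 0 ≤ σ y) →
        MemLp g 2 (volume.restrict (PhaselessSource.sourceSquare a)) →
        MemLp σ 4 (volume.restrict (PhaselessSource.sourceSquare a)) →
        PhaselessSource.IsMildSolution P W a k g σ u →
      ∀ j : ℕ, 1 ≤ j → j ≤ m →
      ∀ v : Fin 2 → PhaselessSource.Plane → Ω → ℂ,
        (∀ l, v l = PhaselessSource.referenceField 1 k
          (PhaselessSource.refPoint R m j (lam l)) u) →
      ∀ x ∈ PhaselessSource.arc R m j,
        |Var[fun ω => (u x ω).re; P]|
            + |cov[fun ω => (u x ω).re, fun ω => (u x ω).im; P]|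
            + |Var[fun ω => (u x ω).im; P]|
          ≤ C k R ((20 * τ - 7) / (20 * τ)) (4 / 9) (lam 1) *
            ∑ l₁ : Fin 2, ∑ l₂ ∈ Finset.Ici l₁,
              (|cov[fun ω => ‖v l₁ x ω‖ ^ 2, fun ω => ‖v l₂ x ω‖ ^ 2; P]|
                + |cov[fun ω => ‖u x ω‖ ^ 2, fun ω => ‖v l₁ x ω‖ ^ 2; P]|
                + |cov[fun ω => ‖u x ω‖ ^ 2, fun ω => ‖v l₂ x ω‖ ^ 2; P]|
                + |Var[fun ω => ‖u x ω‖ ^ 2; P]|) := by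
  choose C hC using PhaselessSource.exists_stability_bound
  refine ⟨fun k R _ _ l => C k R l, ?_⟩
  intro a τ k R m lam hpar Ω _ P _ W g σ u hW _ _ _ _ _ _ _ hu j _ _ v hv x hx
  obtain ⟨θ, hθ1, hθ2, rfl⟩ := hx
  have hφ := PhaselessSource.angle_mem hpar.ten_le_m hθ1 hθ2
  set x : PhaselessSource.Plane := !₂[R * Real.cos θ, R * Real.sin θ]
  set φ := θ - PhaselessSource.nu m (2 * (j : ℝ) - 1)
  obtain ⟨hU, hV⟩ := hu.memLp hW x
  have hgre : ∀ l, (PhaselessSource.greenFn k x (PhaselessSource.refPoint R m j (lam l))).re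
      = PhaselessSource.besselY0 (PhaselessSource.scaledDist (k * R) (lam l) φ) / 4 := fun l => by
    rw [(PhaselessSource.greenFn_re_im _ _ _).1,
      PhaselessSource.mul_norm_sub_refPoint hpar.pos.2.le]
  have hgim : ∀ l, (PhaselessSource.greenFn k x (PhaselessSource.refPoint R m j (lam l))).im
      = -(PhaselessSource.besselJ0 (PhaselessSource.scaledDist (k * R) (lam l) φ) / 4) :=
    fun l => by
      rw [(PhaselessSource.greenFn_re_im _ _ _).2,
        PhaselessSource.mul_norm_sub_refPoint hpar.pos.2.le]
  have hvx : ∀ l ω, v l x ω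
      = u x ω + PhaselessSource.greenFn k x (PhaselessSource.refPoint R m j (lam l)) :=
    fun l ω => by simp [hv, PhaselessSource.referenceField]
  have hmain := PhaselessSource.second_moments_le hU hV
    (fun l => PhaselessSource.greenFn k x (PhaselessSource.refPoint R m j (lam l)))
    (by simp only [hgre, hgim]; exact PhaselessSource.cross_ne_zero hpar hφ)
  simp only [hgre, hgim] at hmain
  simp only [hvx]
  exact hmain.trans (mul_le_mul_of_nonneg_right (hC k R (lam 1) a τ m lam hpar rfl φ hφ)
    (by positivity))
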